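/- Let $V=(V,Y,\mathbf 1,\omega)$ be a vertex operator algebra over $\mathbb C$: it is $\mathbb Z$-graded by eigenspaces of $L(0)$, $V=\bigoplus_{n\in\mathbb Z}V_n$ with $V_n=\{v\in V\mid L(0)v=nv\}$, each $V_n$ is finite-dimensional, and $V_n=0$ for all sufficiently small $n$; here $Y(\omega,z)=\sum_{n\in\mathbb Z}L(n)z^{-n-2}$. A weak $V$-module is a complex vector space $M$ with a linear map $v\mapsto Y_M(v,z)=\sum_{n\in\mathbb Z}v_nz^{-n-1}$, $v_n\in\mathrm{End}\,M$, such that $v_nw=0$ for $n$ large (for each $v\in V$, $w\in M$), $Y_M(\mathbf 1,z)=\mathrm{id}_M$, and the Jacobi identity holds. A $V$-module is a weak $V$-module $M$ with $M=\bigoplus_{\lambda\in\mathbb C}M_\lambda$, where $M_\lambda=\{w\in M\mid L(0)w=\lambda w\}$ is finite-dimensional for every $\lambda$ and, for each fixed $\lambda$, $M_{\lambda+n}=0$ for all sufficiently small integers $n$. A $V$-module is simple if it is nonzero and has no submodules (subspaces stable under all $v_n$) other than $0$ and itself. Suppose that $V$ is holomorphic, i.e. $V$ is itself a simple $V$-module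 and every simple $V$-module is isomorphic to $V$, and suppose that $V_1=0$. Then every $V$-module is completely reducible, i.e. is a direct sum of simple $V$-modules. -/

import Mathlib

universe u v

/-- The Jacobi identity for a state-field correspondence `YV` on `V` acting on `M` through `YM`,
$$z_0^{-1}\delta(\tfrac{z_1-z_2}{z_0})Y_M(a,z_1)Y_M(b,z_2)
  -z_0^{-1}\delta(\tfrac{z_2-z_1}{-z_0})Y_M(b,z_2)Y_M(a,z_1)
  =z_2^{-1}\delta(\tfrac{z_1-z_0}{z_2})Y_M(Y(a,z_0)b,z_2),$$
written out as the equality, applied to a vector `w`, of the coefficients of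
$z_0^{-l-1}z_1^{-m-1}z_2^{-n-1}$ for all integers `l m n`. Here `ncoeff A n` is the coefficient of
$z^{-n-1}$ in the field `A`. All three sums have finite support, since a `VertexOperator` takes
values in Laurent series. -/
def JacobiIdentity {V : Type u} [AddCommGroup V] [Module ℂ V]
    {M : Type v} [AddCommGroup M] [Module ℂ M]
    (YV : V →ₗ[ℂ] VertexOperator ℂ V) (YM : V →ₗ[ℂ] VertexOperator ℂ M) : Prop :=
  ∀ (a b : V) (w : M) (l m n : ℤ),
    (∑ᶠ i : ℕ, ((-1 : ℂ) ^ i * (Ring.choose l i : ℤ)) •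
        (YM a).ncoeff (l + m - i) ((YM b).ncoeff (n + i) w))
      - (∑ᶠ i : ℕ, ((-1 : ℂ) ^ l * (-1 : ℂ) ^ i * (Ring.choose l i : ℤ)) •
        (YM b).ncoeff (l + n - i) ((YM a).ncoeff (m + i) w))
      = ∑ᶠ i : ℕ, ((Ring.choose m i : ℤ) : ℂ) •
        (YM ((YV a).ncoeff (l + i) b)).ncoeff (m + n - i) w

/-- The structure of a vertex operator algebra on the complex vector space `V`. The
$\mathbb{Z}$-grading is the one by eigenspaces of $L(0)$, where
$Y(\omega,z)=\sum_n L(n)z^{-n-2}$, that is $L(n)=\omega_{n+1}$. -/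
structure VertexOperatorAlgebra (V : Type u) [AddCommGroup V] [Module ℂ V] where
  /-- The state-field correspondence; `VertexOperator` contains the truncation condition
  $a_n b = 0$ for $n \gg 0$. -/
  Y : V →ₗ[ℂ] VertexOperator ℂ V
  /-- The vacuum vector. -/
  vac : V
  /-- The conformal (Virasoro) vector. -/
  ω : V
  /-- The rank (central charge). -/
  rank : ℂ
  /-- $Y(\mathbf 1,z)=\mathrm{id}$. -/
  vacuum : ∀ n : ℤ, (Y vac).ncoeff n = if n = -1 then LinearMap.id else 0
  /-- $Y(a,z)\mathbf 1$ has no negative powers of $z$. -/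
  creation : ∀ (a : V) (n : ℤ), 0 ≤ n → (Y a).ncoeff n vac = 0
  /-- The constant term of $Y(a,z)\mathbf 1$ is `a`. -/
  creation_neg_one : ∀ a : V, (Y a).ncoeff (-1) vac = a
  jacobi : JacobiIdentity Y Y
  /-- The Virasoro relations. -/
  virasoro : ∀ (m n : ℤ) (a : V),
    (Y ω).ncoeff (m + 1) ((Y ω).ncoeff (n + 1) a)
        - (Y ω).ncoeff (n + 1) ((Y ω).ncoeff (m + 1) a)
      = ((m : ℂ) - n) • (Y ω).ncoeff (m + n + 1) a
        + (if m + n = 0 then (((m : ℂ) ^ 3 - m) / 12) * rank else 0) • a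
  /-- $Y(L(-1)a,z)=\frac{d}{dz}Y(a,z)$. -/
  derivative : ∀ (a : V) (n : ℤ),
    (Y ((Y ω).ncoeff 0 a)).ncoeff n = (-(n : ℂ)) • (Y a).ncoeff (n - 1)
  /-- `V` is the direct sum of the eigenspaces of $L(0)$ with integral eigenvalue. -/
  grading : DirectSum.IsInternal
    fun n : ℤ => Module.End.eigenspace ((Y ω).ncoeff 1) (n : ℂ)
  finite_dim : ∀ n : ℤ,
    FiniteDimensional ℂ (Module.End.eigenspace ((Y ω).ncoeff 1) (n : ℂ))
  bounded_below : ∃ N : ℤ, ∀ n : ℤ, n < N →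
    Module.End.eigenspace ((Y ω).ncoeff 1) (n : ℂ) = ⊥

namespace VertexOperatorAlgebra

variable {V : Type u} [AddCommGroup V] [Module ℂ V]

/-- The homogeneous space $V_n$ of weight `n`. -/
def weightSpace (A : VertexOperatorAlgebra V) (n : ℤ) : Submodule ℂ V :=
  Module.End.eigenspace ((A.Y A.ω).ncoeff 1) (n : ℂ)

/-- The structure of a weak module for the vertex operator algebra `A` on the vector space `M`. -/
structure WeakModule (A : VertexOperatorAlgebra V) (M : Type v) [AddCommGroup M] [Module ℂ M] where
  /-- The fields $Y_M(a,z)$; `VertexOperator` contains the truncation condition. -/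
  Y : V →ₗ[ℂ] VertexOperator ℂ M
  /-- $Y_M(\mathbf 1,z)=\mathrm{id}$. -/
  vacuum : ∀ n : ℤ, (Y A.vac).ncoeff n = if n = -1 then LinearMap.id else 0
  jacobi : JacobiIdentity A.Y Y

/-- `V` as a module over itself. -/
def adjoint (A : VertexOperatorAlgebra V) : A.WeakModule V where
  Y := A.Y
  vacuum := A.vacuum
  jacobi := A.jacobi

namespace WeakModule

variable {A : VertexOperatorAlgebra V}

/-- The mode $a_n$ acting on `M`, where $Y_M(a,z)=\sum_n a_n z^{-n-1}$. -/
def mode {M : Type v} [AddCommGroup M] [Module ℂ M] (W : A.WeakModule M) (a : V) (n : ℤ) :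
    Module.End ℂ M :=
  (W.Y a).ncoeff n

/-- The space $M_\lambda=\{w \mid L(0)w=\lambda w\}$. -/
def weightSpace {M : Type v} [AddCommGroup M] [Module ℂ M] (W : A.WeakModule M) (lam : ℂ) :
    Submodule ℂ M :=
  Module.End.eigenspace (W.mode A.ω 1) lam

/-- A weak module is an (ordinary) module if it is the direct sum of the eigenspaces $M_\lambda$
($\lambda\in\mathbb C$) of $L(0)$, every $M_\lambda$ is finite-dimensional and, for each fixed
$\lambda$, $M_{\lambda+n}=0$ for all sufficiently small integers $n$. -/
structure IsOrdinary {M : Type v} [AddCommGroup M] [Module ℂ M] (W : A.WeakModule M) :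
    Prop where
  grading : DirectSum.IsInternal W.weightSpace
  finite_dim : ∀ lam : ℂ, FiniteDimensional ℂ (W.weightSpace lam)
  bounded_below : ∀ lam : ℂ, ∃ N : ℤ, ∀ n : ℤ, n < N → W.weightSpace (lam + n) = ⊥

/-- Subspaces stable under all modes. A submodule of an ordinary module is automatically graded
by its $L(0)$-eigenspaces, hence again an ordinary module. -/
def IsSubmodule {M : Type v} [AddCommGroup M] [Module ℂ M] (W : A.WeakModule M)
    (N : Submodule ℂ M) : Prop :=
  ∀ (a : V) (n : ℤ), ∀ w ∈ N, W.mode a n w ∈ N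

/-- `M` is simple: it is nonzero and `0` and `M` are its only submodules. -/
def IsSimple {M : Type v} [AddCommGroup M] [Module ℂ M] (W : A.WeakModule M) : Prop :=
  Nontrivial M ∧ ∀ N : Submodule ℂ M, W.IsSubmodule N → N = ⊥ ∨ N = ⊤

/-- `N` is a submodule of `M` which is simple as a module. -/
def IsSimpleSubmodule {M : Type v} [AddCommGroup M] [Module ℂ M] (W : A.WeakModule M)
    (N : Submodule ℂ M) : Prop :=
  W.IsSubmodule N ∧ N ≠ ⊥ ∧
    ∀ N' : Submodule ℂ M, N' ≤ N → W.IsSubmodule N' → N' = ⊥ ∨ N' = N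

open scoped Classical in
/-- `M` is completely reducible: it is a direct sum of simple submodules. -/
def IsCompletelyReducible {M : Type v} [AddCommGroup M] [Module ℂ M] (W : A.WeakModule M) :
    Prop :=
  ∃ (ι : Type v) (S : ι → Submodule ℂ M),
    (∀ i, W.IsSimpleSubmodule (S i)) ∧ DirectSum.IsInternal S

/-- Equivalence (isomorphism) of modules: a linear isomorphism commuting with all modes. -/
def Equivalent {M : Type u} [AddCommGroup M] [Module ℂ M] {M' : Type v} [AddCommGroup M']
    [Module ℂ M'] (W : A.WeakModule M) (W' : A.WeakModule M') : Prop :=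
  ∃ e : M ≃ₗ[ℂ] M', ∀ (a : V) (n : ℤ) (w : M), e (W.mode a n w) = W'.mode a n (e w)

end WeakModule

/-- `V` is holomorphic: `V` is the only simple `V`-module up to equivalence, i.e. `V` is itself
simple, and every simple (ordinary) `V`-module is equivalent to `V`. -/
def IsHolomorphic (A : VertexOperatorAlgebra V) : Prop :=
  A.adjoint.IsSimple ∧
    ∀ (M : Type v) [AddCommGroup M] [Module ℂ M] (W : A.WeakModule M),
      W.IsOrdinary → W.IsSimple → A.adjoint.Equivalent W

end VertexOperatorAlgebra

/-! The socle of `M` is everything. Let `K` be a submodule containing all simple submodules, and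
suppose `M ⧸ K` is nonzero. It has a simple ordinary subquotient, necessarily a copy of `V`; the
vacuum there has weight 0, so `M ⧸ K` has a nonzero weight-0 vector, which lifts to `w` in `M_0`
(`weightSpace_zero_ne_bot`, `quotient_weightSpace`).

On the other hand, every weight of `M` is a weight of `V`, because a nonzero weight vector survives
in some simple subquotient (`weightSpace_adjoint_ne_bot`). Hence `V_1 = 0` gives `M_1 = 0`, and
`L(-1)w`, which lies in `M_1`, vanishes. Such a vacuum-like `w` makes `a ↦ a_{-1} w` a module map
from `V`, whose image is a simple submodule containing `w` (`isSimpleSubmodule_range_creationMap`).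
So `w` lies in `K`, a contradiction. -/

/-! ### Diagonalizable operators on subspaces and quotients -/

namespace Module.End

variable {M : Type*} [AddCommGroup M] [Module ℂ M]

/-- Applying `f - ν` kills the `ν`-term and scales each other term by `μ - ν ≠ 0`. The family `y` is
quantified inside the induction so that it can be replaced by the scaled one. -/
theorem mem_of_sum_mem_of_mem_eigenspace (f : Module.End ℂ M) {N : Submodule ℂ M}
    (hN : ∀ x ∈ N, f x ∈ N) (s : Finset ℂ) :
    ∀ y : ℂ → M, (∀ μ ∈ s, f (y μ) = μ • y μ) → ∑ μ ∈ s, y μ ∈ N → ∀ μ ∈ s, y μ ∈ N := by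
  classical
  induction s using Finset.induction_on with
  | empty => simp
  | insert ν s hν ih =>
    intro y hy hsum
    have hs : ∀ μ ∈ s, y μ ∈ N := by
      intro μ hμ
      have hne : μ - ν ≠ 0 := sub_ne_zero.2 (fun h => hν (h ▸ hμ))
      have key := ih (fun μ => (μ - ν) • y μ) (fun μ hμ => by
        rw [map_smul, hy μ (Finset.mem_insert_of_mem hμ), smul_comm]) ?_ μ hμ
      · simpa [smul_smul, inv_mul_cancel₀ hne] using N.smul_mem (μ - ν)⁻¹ key
      · have h1 := N.sub_mem (hN _ hsum) (N.smul_mem ν hsum)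
        rw [Finset.sum_insert hν, map_add, smul_add, hy ν (Finset.mem_insert_self _ _),
          add_sub_add_left_eq_sub, map_sum, Finset.smul_sum, ← Finset.sum_sub_distrib] at h1
        convert h1 using 1
        refine Finset.sum_congr rfl fun μ hμ => ?_
        rw [hy μ (Finset.mem_insert_of_mem hμ), sub_smul]
    intro μ hμ
    rcases Finset.mem_insert.1 hμ with rfl | h
    · rw [Finset.sum_insert hν] at hsum
      exact (N.add_mem_iff_left (N.sum_mem hs)).1 hsum
    · exact hs μ h

theorem exists_sum_of_iSup_eigenspace_eq_top {f : Module.End ℂ M}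
    (hf : ⨆ μ, f.eigenspace μ = ⊤) (x : M) :
    ∃ (s : Finset ℂ) (y : ℂ → M), (∀ μ, f (y μ) = μ • y μ) ∧ ∑ μ ∈ s, y μ = x := by
  obtain ⟨y, hy, hx⟩ := (Submodule.mem_iSup_iff_exists_finsupp _ x).1
    (hf.symm ▸ Submodule.mem_top : x ∈ ⨆ μ, f.eigenspace μ)
  exact ⟨y.support, y, fun μ => mem_eigenspace_iff.1 (hy μ), hx⟩

theorem iSup_eigenspace_restrict_of_iSup_eigenspace {f : Module.End ℂ M}
    (hf : ⨆ μ, f.eigenspace μ = ⊤) {N : Submodule ℂ M} (hN : ∀ x ∈ N, f x ∈ N) :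
    ⨆ μ, Module.End.eigenspace (f.restrict hN) μ = ⊤ := by
  rw [eq_top_iff]
  rintro ⟨x, hx⟩ -
  obtain ⟨s, y, hy, hs⟩ := exists_sum_of_iSup_eigenspace_eq_top hf x
  have hyN := mem_of_sum_mem_of_mem_eigenspace f hN s y (fun μ _ => hy μ) (hs ▸ hx)
  have : (⟨x, hx⟩ : N) = ∑ μ ∈ s.attach, ⟨y μ, hyN μ μ.2⟩ := by
    ext
    simp [← hs, Finset.sum_attach s y]
  rw [this]
  refine Submodule.sum_mem _ fun μ _ => ?_
  refine Submodule.mem_iSup_of_mem (μ : ℂ) (mem_eigenspace_iff.2 ?_)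
  ext
  simpa using hy μ

/-- The images of the eigenspaces of `f` span `Q` and sit inside the eigenspaces of `g`, which are
independent; the modular law then leaves no room for a strict inclusion. -/
theorem eigenspace_eq_map_of_surjective {Q : Type*} [AddCommGroup Q] [Module ℂ Q]
    {f : Module.End ℂ M} (hf : ⨆ μ, f.eigenspace μ = ⊤) {g : Module.End ℂ Q} {p : M →ₗ[ℂ] Q}
    (hp : Function.Surjective p) (h : ∀ x, p (f x) = g (p x)) (μ : ℂ) :
    g.eigenspace μ = (f.eigenspace μ).map p := by
  have hle : ∀ ν, (f.eigenspace ν).map p ≤ g.eigenspace ν := by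
    rintro ν _ ⟨x, hx, rfl⟩
    rw [mem_eigenspace_iff, ← h, mem_eigenspace_iff.1 hx, map_smul]
  have htop : ⨆ ν, (f.eigenspace ν).map p = ⊤ := by
    rw [← Submodule.map_iSup, hf, Submodule.map_top, LinearMap.range_eq_top.2 hp]
  refine le_antisymm ?_ (hle μ)
  have hdisj := g.eigenspaces_iSupIndep μ
  have hsup : (f.eigenspace μ).map p ⊔ ⨆ ν, ⨆ _ : ν ≠ μ, g.eigenspace ν = ⊤ := by
    rw [eq_top_iff, ← htop]
    refine iSup_le fun ν => ?_
    by_cases hν : ν = μ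
    · exact hν ▸ le_sup_left
    · exact (hle ν).trans (le_sup_of_le_right (le_iSup₂_of_le ν hν le_rfl))
  calc g.eigenspace μ
      = ((f.eigenspace μ).map p ⊔ ⨆ ν, ⨆ _ : ν ≠ μ, g.eigenspace ν) ⊓ g.eigenspace μ := by
        rw [hsup, top_inf_eq]
    _ = (f.eigenspace μ).map p ⊔ (⨆ ν, ⨆ _ : ν ≠ μ, g.eigenspace ν) ⊓ g.eigenspace μ :=
        sup_inf_assoc_of_le _ (hle μ)
    _ ≤ (f.eigenspace μ).map p := by
        rw [inf_comm, hdisj.eq_bot, sup_bot_eq]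

theorem iSup_eigenspace_of_surjective {Q : Type*} [AddCommGroup Q] [Module ℂ Q]
    {f : Module.End ℂ M} (hf : ⨆ μ, f.eigenspace μ = ⊤) {g : Module.End ℂ Q} {p : M →ₗ[ℂ] Q}
    (hp : Function.Surjective p) (h : ∀ x, p (f x) = g (p x)) :
    ⨆ μ, g.eigenspace μ = ⊤ := by
  simp_rw [eigenspace_eq_map_of_surjective hf hp h]
  rw [← Submodule.map_iSup, hf, Submodule.map_top, LinearMap.range_eq_top.2 hp]

end Module.End

/-! ### Fields determined by their modes -/

namespace VertexOperator

variable {M : Type*} [AddCommGroup M] [Module ℂ M]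

theorem ncoeff_eventually_zero (F : VertexOperator ℂ M) (x : M) :
    ∃ N : ℤ, ∀ n, N ≤ n → F.ncoeff n x = 0 :=
  ⟨-((HahnModule.of ℂ).symm (F x)).order, fun n hn =>
    ncoeff_eq_zero_of_lt_order F n x (by lia)⟩

theorem ncoeff_injective : Function.Injective (ncoeff (R := ℂ) (V := M)) := by
  intro F G h
  refine HVertexOperator.coeff_inj (funext fun n => ?_)
  simp [coeff_eq_ncoeff, h]

end VertexOperator

theorem hasFiniteSupport_of_eventually_zero {M : Type*} [AddCommGroup M] {F : ℕ → M} {N : ℤ}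
    (h : ∀ i : ℕ, N ≤ i → F i = 0) : F.HasFiniteSupport := by
  refine (Set.finite_lt_nat N.toNat).subset fun i hi => ?_
  by_contra hlt
  exact hi (h i (by simp at hlt; lia))

namespace VertexOperatorAlgebra

variable {V : Type u} [AddCommGroup V] [Module ℂ V] {A : VertexOperatorAlgebra V}

namespace WeakModule

section Transfer

variable {Q : Type*} [AddCommGroup Q] [Module ℂ Q]

theorem bddBelow_support_of_eventually_zero {μ : ℤ → Module.End ℂ Q}
    (hμ : ∀ x, ∃ N : ℤ, ∀ n, N ≤ n → μ n x = 0) (x : Q) :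
    -- The mode of index `n` is the coefficient of `z^k` with `k = -n - 1`.
    BddBelow (Function.support fun k : ℤ => μ (-k - 1) x) := by
  obtain ⟨N, hN⟩ := hμ x
  refine ⟨-N, fun k hk => ?_⟩
  by_contra hlt
  exact hk (hN _ (by lia))

theorem ncoeff_of_coeff_neg {μ : ℤ → Module.End ℂ Q}
    (hμ : ∀ x, ∃ N : ℤ, ∀ n, N ≤ n → μ n x = 0) :
    VertexOperator.ncoeff
      (VertexOperator.of_coeff _ (bddBelow_support_of_eventually_zero hμ)) = μ := by
  ext1 n
  rw [VertexOperator.ncoeff_of_coeff]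
  congr 1
  lia

/-- The state-field correspondence with prescribed modes. -/
noncomputable def fieldOfModes (μ : V →ₗ[ℂ] ℤ → Module.End ℂ Q)
    (hμ : ∀ a x, ∃ N : ℤ, ∀ n, N ≤ n → μ a n x = 0) : V →ₗ[ℂ] VertexOperator ℂ Q where
  toFun a := VertexOperator.of_coeff _ (bddBelow_support_of_eventually_zero (hμ a))
  map_add' a b := VertexOperator.ncoeff_injective <|
    (ncoeff_of_coeff_neg (hμ (a + b))).trans <| by
      rw [map_add, map_add, ncoeff_of_coeff_neg (hμ a), ncoeff_of_coeff_neg (hμ b)]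
  map_smul' c a := VertexOperator.ncoeff_injective <|
    (ncoeff_of_coeff_neg (hμ (c • a))).trans <| by
      rw [RingHom.id_apply, map_smul, map_smul, ncoeff_of_coeff_neg (hμ a)]

theorem ncoeff_fieldOfModes (μ : V →ₗ[ℂ] ℤ → Module.End ℂ Q)
    (hμ : ∀ a x, ∃ N : ℤ, ∀ n, N ≤ n → μ a n x = 0) (a : V) (n : ℤ) :
    (fieldOfModes μ hμ a).ncoeff n = μ a n :=
  congrFun (ncoeff_of_coeff_neg (hμ a)) n

end Transfer

variable {M : Type v} [AddCommGroup M] [Module ℂ M] (W : A.WeakModule M)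

theorem mode_eventually_zero (a : V) (x : M) : ∃ N : ℤ, ∀ n, N ≤ n → W.mode a n x = 0 :=
  (W.Y a).ncoeff_eventually_zero x

theorem hasFiniteSupport_jacobi_left (c : ℕ → ℂ) (a b : V) (w : M) (l n : ℤ) :
    (fun i : ℕ => c i • W.mode a (l - i) (W.mode b (n + i) w)).HasFiniteSupport := by
  obtain ⟨N, hN⟩ := W.mode_eventually_zero b w
  exact hasFiniteSupport_of_eventually_zero (N := N - n) fun i hi => by
    rw [hN _ (by lia), map_zero, smul_zero]

theorem hasFiniteSupport_jacobi_right (c : ℕ → ℂ) (a b : V) (w : M) (l m : ℤ) :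
    (fun i : ℕ => c i • W.mode (A.adjoint.mode a (l + i) b) (m - i) w).HasFiniteSupport := by
  obtain ⟨N, hN⟩ := A.adjoint.mode_eventually_zero a b
  exact hasFiniteSupport_of_eventually_zero (N := N - l) fun i hi => by
    rw [hN _ (by lia)]
    simp [mode]

theorem jacobi_mode (a b : V) (w : M) (l m n : ℤ) :
    (∑ᶠ i : ℕ, ((-1 : ℂ) ^ i * (Ring.choose l i : ℤ)) •
        W.mode a (l + m - i) (W.mode b (n + i) w))
      - (∑ᶠ i : ℕ, ((-1 : ℂ) ^ l * (-1 : ℂ) ^ i * (Ring.choose l i : ℤ)) •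
        W.mode b (l + n - i) (W.mode a (m + i) w))
      = ∑ᶠ i : ℕ, ((Ring.choose m i : ℤ) : ℂ) •
        W.mode (A.adjoint.mode a (l + i) b) (m + n - i) w :=
  W.jacobi a b w l m n

/-! ### Submodules and quotients of weak and ordinary modules -/

variable {W} {N : Submodule ℂ M} (hN : W.IsSubmodule N)

/-- A submodule as a weak module. -/
noncomputable def restrict : A.WeakModule N where
  Y := fieldOfModes
    { toFun := fun a n => (W.mode a n).restrict (hN a n)
      map_add' := fun a b => by ext; simp [mode]
      map_smul' := fun c a => by ext; simp [mode] }
    fun a x => by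
      obtain ⟨k, hk⟩ := W.mode_eventually_zero a (x : M)
      exact ⟨k, fun n hn => Subtype.ext (hk n hn)⟩
  vacuum n := by
    rw [ncoeff_fieldOfModes]
    have := W.vacuum n
    ext x
    change W.mode A.vac n x = _
    rw [mode, this]
    split_ifs <;> rfl
  jacobi a b w l m n := by
    apply Subtype.ext
    simp only [ncoeff_fieldOfModes]
    have hinj := N.subtype_injective
    have hmap (F : ℕ → N) : ((∑ᶠ i, F i : N) : M) = ∑ᶠ i, (F i : M) :=
      AddMonoidHom.map_finsum_of_injective N.subtype.toAddMonoidHom hinj F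
    rw [Submodule.coe_sub, hmap, hmap, hmap]
    exact W.jacobi a b w l m n

@[simp]
theorem coe_restrict_mode (a : V) (n : ℤ) (x : N) :
    (((restrict hN).mode a n x : N) : M) = W.mode a n x := by
  rw [mode, restrict, ncoeff_fieldOfModes]
  rfl

/-- The quotient of a weak module by a submodule. -/
noncomputable def quotient : A.WeakModule (M ⧸ N) where
  Y := fieldOfModes
    { toFun := fun a n => N.mapQ N (W.mode a n) (hN a n)
      map_add' := fun a b => by
        ext n x
        simp [mode]
      map_smul' := fun c a => by
        ext n x
        simp [mode] }
    fun a x => by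
      obtain ⟨x, rfl⟩ := N.mkQ_surjective x
      obtain ⟨k, hk⟩ := W.mode_eventually_zero a x
      exact ⟨k, fun n hn => by simp [hk n hn]⟩
  vacuum n := by
    rw [ncoeff_fieldOfModes]
    have := W.vacuum n
    ext x
    change N.mkQ (W.mode A.vac n x) = _
    rw [mode, this]
    split_ifs <;> simp
  jacobi a b w l m n := by
    obtain ⟨w, rfl⟩ := N.mkQ_surjective w
    simp only [ncoeff_fieldOfModes]
    have key := congrArg N.mkQ (W.jacobi_mode a b w l m n)
    -- The projection is not injective, so unlike for a submodule it commutes with `finsum` only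
    -- when the support is known to be finite.
    have hmap (F : ℕ → M) (hF : F.HasFiniteSupport) :
        N.mkQ (∑ᶠ i, F i) = ∑ᶠ i, N.mkQ (F i) :=
      AddMonoidHom.map_finsum N.mkQ.toAddMonoidHom hF
    rw [map_sub, hmap _ (W.hasFiniteSupport_jacobi_left _ _ _ _ _ _),
      hmap _ (W.hasFiniteSupport_jacobi_left _ _ _ _ _ _),
      hmap _ (W.hasFiniteSupport_jacobi_right _ _ _ _ _ _)] at key
    exact key

@[simp]
theorem quotient_mode_mkQ (a : V) (n : ℤ) (x : M) :
    (quotient hN).mode a n (N.mkQ x) = N.mkQ (W.mode a n x) := by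
  rw [mode, quotient, ncoeff_fieldOfModes]
  rfl

theorem IsOrdinary.iSup_weightSpace (hW : W.IsOrdinary) : ⨆ μ, W.weightSpace μ = ⊤ :=
  hW.grading.submodule_iSup_eq_top

theorem isInternal_weightSpace (h : ⨆ μ, W.weightSpace μ = ⊤) :
    DirectSum.IsInternal W.weightSpace :=
  DirectSum.isInternal_submodule_of_iSupIndep_of_iSup_eq_top
    (Module.End.eigenspaces_iSupIndep _) h

theorem mem_weightSpace_iff {μ : ℂ} {x : M} :
    x ∈ W.weightSpace μ ↔ W.mode A.ω 1 x = μ • x :=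
  Module.End.mem_eigenspace_iff

theorem IsOrdinary.quotient_weightSpace (hW : W.IsOrdinary) (μ : ℂ) :
    (quotient hN).weightSpace μ = (W.weightSpace μ).map N.mkQ :=
  Module.End.eigenspace_eq_map_of_surjective hW.iSup_weightSpace N.mkQ_surjective
    (fun x => (quotient_mode_mkQ hN _ _ x).symm) μ

theorem IsOrdinary.quotient (hW : W.IsOrdinary) : (quotient hN).IsOrdinary where
  grading := isInternal_weightSpace <|
    Module.End.iSup_eigenspace_of_surjective hW.iSup_weightSpace N.mkQ_surjective
      (fun x => (quotient_mode_mkQ hN _ _ x).symm)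
  finite_dim μ := by
    have := hW.finite_dim μ
    rw [hW.quotient_weightSpace]
    infer_instance
  bounded_below μ := by
    obtain ⟨k, hk⟩ := hW.bounded_below μ
    exact ⟨k, fun n hn => by rw [hW.quotient_weightSpace, hk n hn, Submodule.map_bot]⟩

theorem restrict_weightSpace (μ : ℂ) :
    (restrict hN).weightSpace μ = (W.weightSpace μ).comap N.subtype := by
  ext x
  rw [Submodule.mem_comap, mem_weightSpace_iff, mem_weightSpace_iff, Subtype.ext_iff]
  simp

theorem IsOrdinary.restrict (hW : W.IsOrdinary) : (restrict hN).IsOrdinary where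
  grading := isInternal_weightSpace <| by
    have := Module.End.iSup_eigenspace_restrict_of_iSup_eigenspace hW.iSup_weightSpace (hN A.ω 1)
    rw [← this]
    refine iSup_congr fun μ => ?_
    rw [WeakModule.weightSpace]
    congr 1
  finite_dim μ := by
    have := hW.finite_dim μ
    rw [restrict_weightSpace]
    exact Module.Finite.of_injective
      (N.subtype.restrict (p := (W.weightSpace μ).comap N.subtype) (q := W.weightSpace μ)
        fun _ h => h) fun x y h => Subtype.ext (Subtype.ext (congrArg (Subtype.val : W.weightSpace μ → M) h))
  bounded_below μ := by
    obtain ⟨k, hk⟩ := hW.bounded_below μ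
    refine ⟨k, fun n hn => ?_⟩
    rw [restrict_weightSpace, hk n hn, Submodule.comap_bot, Submodule.ker_subtype]

end WeakModule

end VertexOperatorAlgebra

namespace VertexOperatorAlgebra

variable {V : Type u} [AddCommGroup V] [Module ℂ V] {A : VertexOperatorAlgebra V}

namespace WeakModule

/-! ### Translation by `L(-1)` and vacuum-like vectors -/

section Modes

variable {M : Type v} [AddCommGroup M] [Module ℂ M] (W : A.WeakModule M)

theorem mode_vac (n : ℤ) (w : M) : W.mode A.vac n w = if n = -1 then w else 0 := by
  rw [mode, W.vacuum]
  split_ifs <;> rfl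

theorem finsum_choose_zero_smul (F : ℕ → M) :
    ∑ᶠ i : ℕ, ((Ring.choose (0 : ℤ) i : ℤ) : ℂ) • F i = F 0 := by
  rw [finsum_eq_single _ 0 fun i hi => by simp [Ring.choose_zero_pos ℤ (Nat.pos_of_ne_zero hi)]]
  simp

theorem mode_commutator_zero (a b : V) (n : ℤ) (w : M) :
    W.mode a 0 (W.mode b n w) - W.mode b n (W.mode a 0 w)
      = W.mode (A.adjoint.mode a 0 b) n w := by
  have h := W.jacobi_mode a b w 0 0 n
  rw [finsum_eq_single _ 0 fun i hi => by simp [Ring.choose_zero_pos ℤ (Nat.pos_of_ne_zero hi)],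
    finsum_eq_single _ 0 fun i hi => by simp [Ring.choose_zero_pos ℤ (Nat.pos_of_ne_zero hi)],
    finsum_choose_zero_smul] at h
  simpa using h

/-- The Jacobi identity at `m = 0`, where its right-hand side collapses to one term. -/
theorem mode_mode_apply (a b : V) (l n : ℤ) (w : M) :
    W.mode (A.adjoint.mode a l b) n w =
      (∑ᶠ i : ℕ, ((-1 : ℂ) ^ i * (Ring.choose l i : ℤ)) •
        W.mode a (l - i) (W.mode b (n + i) w))
      - ∑ᶠ i : ℕ, ((-1 : ℂ) ^ l * (-1 : ℂ) ^ i * (Ring.choose l i : ℤ)) •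
        W.mode b (l + n - i) (W.mode a i w) := by
  have h := W.jacobi_mode a b w l 0 n
  rw [finsum_choose_zero_smul] at h
  simpa using h.symm

theorem neg_one_pow_mul_choose_neg_two (i : ℕ) :
    (-1 : ℂ) ^ i * ((Ring.choose (-2 : ℤ) i : ℤ) : ℂ) = i + 1 := by
  have : Ring.choose (-2 : ℤ) i = (-1) ^ i * (i + 1) := by
    rw [Ring.choose_neg', Ring.multichoose_two, Units.smul_def, Int.coe_negOnePow_natCast,
      smul_eq_mul]
  rw [this]
  push_cast
  rw [← mul_assoc, ← mul_pow]
  simp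

/-- Only the mode of index -1 of the vacuum is nonzero, so at most one term survives: `i = -1 - n`
in the first sum if `n < 0`, `i = n - 1` in the second if `n > 0`, none if `n = 0`. -/
theorem mode_mode_neg_two_vac (a : V) (n : ℤ) (w : M) :
    W.mode (A.adjoint.mode a (-2) A.vac) n w = (-(n : ℂ)) • W.mode a (n - 1) w := by
  rw [mode_mode_apply]
  simp_rw [mode_vac]
  have e : (-1 : ℂ) ^ (-2 : ℤ) = 1 := by norm_num
  simp_rw [e, one_mul, neg_one_pow_mul_choose_neg_two]
  rcases lt_trichotomy n 0 with hn | rfl | hn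
  · lift -1 - n to ℕ using (by lia) with k hk
    rw [finsum_eq_single _ k fun i hi => by rw [if_neg (by lia), map_zero, smul_zero],
      finsum_eq_zero_of_forall_eq_zero fun i => by rw [if_neg (by lia), smul_zero],
      if_pos (by lia), sub_zero]
    have h1 : (-2 : ℤ) - k = n - 1 := by lia
    have h2 : n = -1 - (k : ℤ) := by lia
    rw [h1, h2]
    congr 1
    push_cast
    ring
  · rw [finsum_eq_zero_of_forall_eq_zero fun i => by rw [if_neg (by lia), map_zero, smul_zero],
      finsum_eq_zero_of_forall_eq_zero fun i => by rw [if_neg (by lia), smul_zero]]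
    simp
  · lift n - 1 to ℕ using (by lia) with k hk
    rw [finsum_eq_zero_of_forall_eq_zero fun i => by rw [if_neg (by lia), map_zero, smul_zero],
      finsum_eq_single _ k fun i hi => by rw [if_neg (by lia), smul_zero],
      if_pos (by lia), zero_sub, ← neg_smul]
    have h2 : n = (k : ℤ) + 1 := by lia
    rw [h2]
    push_cast
    rfl

/-- With this, the `L(-1)`-derivative property on modules follows from the Jacobi identity; it is
not part of `WeakModule`. -/
theorem mode_omega_zero_eq (a : V) : A.adjoint.mode A.ω 0 a = A.adjoint.mode a (-2) A.vac := by
  have h := LinearMap.congr_fun (A.derivative a (-1)) A.vac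
  rw [A.creation_neg_one] at h
  simpa [mode, adjoint] using h

theorem mode_translation (a : V) (n : ℤ) (w : M) :
    W.mode A.ω 0 (W.mode a n w) - W.mode a n (W.mode A.ω 0 w)
      = (-(n : ℂ)) • W.mode a (n - 1) w := by
  rw [mode_commutator_zero, mode_omega_zero_eq, mode_mode_neg_two_vac]

variable {W}

/-- When `L(-1)w = 0`, translation turns `a_{n+1} w = 0` into `(n + 1) a_n w = 0`. Descend from the
truncation bound; the factor is nonzero as long as `n ≥ 0`. -/
theorem mode_eq_zero_of_vacuum_like {w : M} (hw : W.mode A.ω 0 w = 0) (a : V) {n : ℤ}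
    (hn : 0 ≤ n) : W.mode a n w = 0 := by
  obtain ⟨N, hN⟩ := W.mode_eventually_zero a w
  have (k : ℕ) : ∀ n : ℤ, 0 ≤ n → N ≤ n + k → W.mode a n w = 0 := by
    induction k with
    | zero => exact fun n _ h => hN n (by simpa using h)
    | succ k ih =>
      intro n hn h
      have key := W.mode_translation a (n + 1) w
      rw [ih (n + 1) (by lia) (by push_cast at h; lia), hw, map_zero, map_zero, sub_zero,
        add_sub_cancel_right] at key
      refine (smul_eq_zero.1 key.symm).resolve_left ?_
      refine neg_ne_zero.2 ?_
      exact_mod_cast (by lia : n + 1 ≠ 0)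
  exact this (N - n).toNat n hn (by lia)

variable (W) in
/-- The linear map $a \mapsto a_{-1} w$ from `V` to a weak module. -/
noncomputable def creationMap (w : M) : V →ₗ[ℂ] M where
  toFun a := W.mode a (-1) w
  map_add' a b := by simp [mode]
  map_smul' c a := by simp [mode]

/-- In the expansion of `(a_n b)_{-1} w` every term applies a nonnegative mode to `w`, except the
one with `i = 0` in the first sum. -/
theorem creationMap_mode {w : M} (hw : W.mode A.ω 0 w = 0) (a b : V) (n : ℤ) :
    W.creationMap w (A.adjoint.mode a n b) = W.mode a n (W.creationMap w b) := by
  change W.mode _ (-1) w = W.mode a n (W.mode b (-1) w)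
  rw [mode_mode_apply, finsum_eq_single _ 0 fun i hi => by
      rw [mode_eq_zero_of_vacuum_like hw b (by lia), map_zero, smul_zero],
    finsum_eq_zero_of_forall_eq_zero fun i => by
      rw [mode_eq_zero_of_vacuum_like hw a (by lia), map_zero, smul_zero]]
  simp

theorem isSimpleSubmodule_range_creationMap (hA : A.adjoint.IsSimple) {w : M}
    (hw : W.mode A.ω 0 w = 0) (hw0 : w ≠ 0) :
    W.IsSimpleSubmodule (LinearMap.range (W.creationMap w)) ∧
      w ∈ LinearMap.range (W.creationMap w) := by
  have hmem : w ∈ LinearMap.range (W.creationMap w) :=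
    ⟨A.vac, (W.mode_vac (-1) w).trans (if_pos rfl)⟩
  refine ⟨⟨?_, ?_, fun N' hle hN' => ?_⟩, hmem⟩
  · rintro a n _ ⟨b, rfl⟩
    exact ⟨_, creationMap_mode hw a b n⟩
  · exact fun h => hw0 ((Submodule.eq_bot_iff _).1 h w hmem)
  · have hc : A.adjoint.IsSubmodule (N'.comap (W.creationMap w)) := fun a n b hb => by
      rw [Submodule.mem_comap, creationMap_mode hw]
      exact hN' a n _ hb
    have hmap : (N'.comap (W.creationMap w)).map (W.creationMap w) = N' := by
      rw [Submodule.map_comap_eq, inf_eq_right.2 hle]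
    rcases hA.2 _ hc with h | h
    · left
      rw [← hmap, h, Submodule.map_bot]
    · right
      rw [← hmap, h, Submodule.map_top]

end Modes

/-! ### Simple subquotients and the weights they detect -/

section Subquotient

variable {M : Type v} [AddCommGroup M] [Module ℂ M] {W : A.WeakModule M}

theorem IsSubmodule.sInf {S : Set (Submodule ℂ M)} (hS : ∀ N ∈ S, W.IsSubmodule N) :
    W.IsSubmodule (sInf S) := by
  intro a n x hx
  rw [Submodule.mem_sInf] at hx ⊢
  exact fun N hN => hS N hN a n x (hx N hN)

theorem exists_maximal_isSubmodule_notMem {w : M} (hw : w ≠ 0) :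
    ∃ P : Submodule ℂ M, W.IsSubmodule P ∧ w ∉ P ∧
      ∀ N, W.IsSubmodule N → P < N → w ∈ N := by
  obtain ⟨P, hP⟩ := zorn_le₀ {P : Submodule ℂ M | W.IsSubmodule P ∧ w ∉ P} fun c hc hchain => by
    rcases c.eq_empty_or_nonempty with rfl | hne
    · refine ⟨⊥, ⟨fun a n x hx => ?_, by simpa using hw⟩, by simp⟩
      rw [(Submodule.mem_bot ℂ).1 hx, map_zero]
      exact zero_mem _
    · refine ⟨sSup c, ⟨fun a n x hx => ?_, fun hx => ?_⟩, fun _ => le_sSup⟩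
      · obtain ⟨N, hN, hxN⟩ := (Submodule.mem_sSup_of_directed hne hchain.directedOn).1 hx
        exact (Submodule.mem_sSup_of_directed hne hchain.directedOn).2
          ⟨N, hN, (hc hN).1 a n x hxN⟩
      · obtain ⟨N, hN, hxN⟩ := (Submodule.mem_sSup_of_directed hne hchain.directedOn).1 hx
        exact (hc hN).2 hxN
  refine ⟨P, hP.prop.1, hP.prop.2, fun N hN hlt => ?_⟩
  by_contra hwN
  exact hlt.not_ge (hP.le_of_ge ⟨hN, hwN⟩ hlt.le)

variable (W) in
-- Take `P` maximal among submodules avoiding `w`. Every nonzero submodule of `M ⧸ P` then contains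
-- the image of `w`, so the submodule generated by that image is simple.
theorem exists_simple_subquotient {w : M} (hw : w ≠ 0) :
    ∃ (P : Submodule ℂ M) (hP : W.IsSubmodule P) (U : Submodule ℂ (M ⧸ P))
      (hU : (quotient hP).IsSubmodule U),
      (restrict hU).IsSimple ∧ P.mkQ w ∈ U ∧ P.mkQ w ≠ 0 := by
  obtain ⟨P, hP, hwP, hmax⟩ := exists_maximal_isSubmodule_notMem (W := W) hw
  have hne : P.mkQ w ≠ 0 := by simpa using hwP
  have hmin (K : Submodule ℂ (M ⧸ P)) (hK : (quotient hP).IsSubmodule K) (hbot : K ≠ ⊥) :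
      P.mkQ w ∈ K := by
    refine hmax (K.comap P.mkQ) (fun a n x hx => ?_) ?_
    · rw [Submodule.mem_comap, ← quotient_mode_mkQ hP]
      exact hK a n _ hx
    · refine lt_of_le_of_ne (P.le_comap_mkQ K) fun h => hbot ?_
      rw [← Submodule.map_comap_eq_of_surjective P.mkQ_surjective K, ← h, P.mkQ_map_self]
  have hU : (quotient hP).IsSubmodule
      (sInf {K | (quotient hP).IsSubmodule K ∧ P.mkQ w ∈ K}) := .sInf fun _ h => h.1
  have hmem : P.mkQ w ∈ sInf {K | (quotient hP).IsSubmodule K ∧ P.mkQ w ∈ K} :=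
    Submodule.mem_sInf.2 fun _ h => h.2
  refine ⟨P, hP, _, hU, ⟨⟨⟨_, hmem⟩, 0, fun h => hne (Subtype.ext_iff.1 h)⟩, fun N hN => ?_⟩,
    hmem, hne⟩
  refine or_iff_not_imp_left.2 fun hbot => ?_
  have hK : (quotient hP).IsSubmodule (N.map (Submodule.subtype _)) := by
    rintro a n _ ⟨x, hx, rfl⟩
    exact ⟨_, hN a n x hx, coe_restrict_mode hU a n x⟩
  have hwK := hmin _ hK fun h => hbot
    (Submodule.map_injective_of_injective (Submodule.subtype_injective _)
      (h.trans (Submodule.map_bot _).symm))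
  rw [eq_top_iff]
  rintro x -
  obtain ⟨y, hy, hyx⟩ := (Submodule.mem_sInf.1 x.2) _ ⟨hK, hwK⟩
  rwa [← Subtype.ext hyx]

theorem weightSpace_ne_bot_of_equivalent {M₁ : Type u} {M₂ : Type v} [AddCommGroup M₁] [Module ℂ M₁]
    [AddCommGroup M₂] [Module ℂ M₂] {W₁ : A.WeakModule M₁} {W₂ : A.WeakModule M₂}
    (h : W₁.Equivalent W₂) (μ : ℂ) : W₁.weightSpace μ ≠ ⊥ ↔ W₂.weightSpace μ ≠ ⊥ := by
  obtain ⟨e, he⟩ := h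
  have : W₁.weightSpace μ = (W₂.weightSpace μ).comap (e : M₁ →ₗ[ℂ] M₂) := by
    ext x
    rw [Submodule.mem_comap, mem_weightSpace_iff, mem_weightSpace_iff, LinearEquiv.coe_coe, ← he,
      ← map_smul, e.injective.eq_iff]
  rw [this, ne_eq, ne_eq, Submodule.comap_equiv_eq_map_symm, Submodule.map_eq_bot_iff]

theorem weightSpace_adjoint_ne_bot (hol : IsHolomorphic.{u, v} A) (hW : W.IsOrdinary) {μ : ℂ}
    (h : W.weightSpace μ ≠ ⊥) : A.adjoint.weightSpace μ ≠ ⊥ := by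
  obtain ⟨w, hwμ, hw⟩ := Submodule.exists_mem_ne_zero_of_ne_bot h
  obtain ⟨P, hP, U, hU, hsimple, hwU, hw0⟩ := W.exists_simple_subquotient hw
  refine (weightSpace_ne_bot_of_equivalent (hol.2 U (restrict hU) ((hW.quotient hP).restrict hU) hsimple)
    μ).2 (Submodule.ne_bot_iff _ |>.2 ⟨⟨_, hwU⟩, ?_, fun h => hw0 (Subtype.ext_iff.1 h)⟩)
  rw [restrict_weightSpace, Submodule.mem_comap, hW.quotient_weightSpace]
  exact ⟨w, hwμ, rfl⟩

theorem weightSpace_adjoint_zero_ne_bot (hA : A.adjoint.IsSimple) :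
    A.adjoint.weightSpace 0 ≠ ⊥ := by
  have := hA.1
  obtain ⟨a, ha⟩ := exists_ne (0 : V)
  refine (Submodule.ne_bot_iff _).2 ⟨A.vac, mem_weightSpace_iff.2 ?_, fun h => ha ?_⟩
  · rw [zero_smul]
    exact A.creation A.ω 1 zero_le_one
  · rw [← A.creation_neg_one a, h, map_zero]

theorem weightSpace_zero_ne_bot [Nontrivial M] (hol : IsHolomorphic.{u, v} A)
    (hW : W.IsOrdinary) : W.weightSpace 0 ≠ ⊥ := by
  obtain ⟨w, hw⟩ := exists_ne (0 : M)
  obtain ⟨P, hP, U, hU, hsimple, -, -⟩ := W.exists_simple_subquotient hw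
  have h := (weightSpace_ne_bot_of_equivalent
    (hol.2 U (restrict hU) ((hW.quotient hP).restrict hU) hsimple) 0).1
    (weightSpace_adjoint_zero_ne_bot hol.1)
  intro hbot
  rw [restrict_weightSpace, hW.quotient_weightSpace, hbot, Submodule.map_bot,
    Submodule.comap_bot, Submodule.ker_subtype] at h
  exact h rfl

/-- The translation formula for `ω` at index 1 reads `[L(-1), L(0)] = -L(-1)`. -/
theorem mode_omega_zero_mem_weightSpace {μ : ℂ} {w : M} (hw : w ∈ W.weightSpace μ) :
    W.mode A.ω 0 w ∈ W.weightSpace (μ + 1) := by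
  have h := W.mode_translation A.ω 1 w
  rw [mem_weightSpace_iff] at hw ⊢
  rw [hw, map_smul, sub_self] at h
  rw [add_smul, one_smul]
  push_cast at h
  rw [neg_one_smul, sub_eq_iff_eq_add] at h
  rw [h]
  abel_nf

end Subquotient

/-! ### Complete reducibility as semisimplicity over the algebra of modes -/

section Semisimple

variable {M : Type v} [AddCommGroup M] [Module ℂ M] (W : A.WeakModule M)

/-- The algebra of operators generated by the modes. -/
noncomputable abbrev modeAlgebra : Subalgebra ℂ (Module.End ℂ M) :=
  Algebra.adjoin ℂ {f | ∃ a n, f = W.mode a n}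

variable {W}

/-- A submodule of a weak module as a module over the algebra generated by the modes. -/
noncomputable def IsSubmodule.toModeAlgebra {N : Submodule ℂ M} (hN : W.IsSubmodule N) :
    Submodule W.modeAlgebra M where
  __ := N
  smul_mem' := by
    rintro ⟨f, hf⟩
    change ∀ x ∈ N, f x ∈ N
    induction hf using Algebra.adjoin_induction with
    | mem f hf =>
      obtain ⟨a, n, rfl⟩ := hf
      exact fun x hx => hN a n x hx
    | algebraMap c => exact fun x hx => N.smul_mem c hx
    | add f g _ _ hf hg => exact fun x hx => N.add_mem (hf x hx) (hg x hx)
    | mul f g _ _ hf hg => exact fun x hx => hf _ (hg x hx)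

theorem isSubmodule_restrictScalars (N : Submodule W.modeAlgebra M) :
    W.IsSubmodule (N.restrictScalars ℂ) := fun a n _ hx =>
  N.smul_mem ⟨W.mode a n, Algebra.subset_adjoin ⟨a, n, rfl⟩⟩ hx

theorem isSimpleSubmodule_restrictScalars_iff {N : Submodule W.modeAlgebra M} :
    W.IsSimpleSubmodule (N.restrictScalars ℂ) ↔ IsSimpleModule W.modeAlgebra N := by
  rw [isSimpleModule_iff_isAtom]
  constructor
  · rintro ⟨-, hne, h⟩
    refine ⟨fun hbot => hne (by rw [hbot]; rfl), fun K hK => ?_⟩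
    rcases h (K.restrictScalars ℂ) (fun x hx => hK.le hx) (isSubmodule_restrictScalars K) with
      h | h
    · exact Submodule.restrictScalars_injective ℂ _ _ h
    · exact absurd (Submodule.restrictScalars_injective ℂ _ _ h) hK.ne
  · intro h
    refine ⟨isSubmodule_restrictScalars N, fun hbot => h.1 ?_, fun K hle hK => ?_⟩
    · exact Submodule.restrictScalars_injective ℂ _ _ hbot
    · have hle' : hK.toModeAlgebra ≤ N := hle
      rcases h.le_iff.1 hle' with h | h
      · exact Or.inl (congrArg (Submodule.restrictScalars ℂ) h)
      · exact Or.inr (congrArg (Submodule.restrictScalars ℂ) h)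

theorem isCompletelyReducible_of_isSemisimpleModule (h : IsSemisimpleModule W.modeAlgebra M) :
    W.IsCompletelyReducible := by
  obtain ⟨s, hind, htop, hs⟩ :=
    IsSemisimpleModule.exists_sSupIndep_sSup_simples_eq_top W.modeAlgebra M
  have hind' : iSupIndep fun N : s => N.1.restrictScalars ℂ := fun N => by
    have := (sSupIndep_iff s).1 hind N
    simp_rw [← Submodule.restrictScalars_iSup]
    rw [Submodule.disjoint_def] at this ⊢
    exact this
  have htop' : ⨆ N : s, N.1.restrictScalars ℂ = ⊤ := by
    rw [← Submodule.restrictScalars_iSup, ← sSup_eq_iSup', htop]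
    rfl
  refine ⟨s, fun N => N.1.restrictScalars ℂ,
    fun N => isSimpleSubmodule_restrictScalars_iff.2 (hs N.1 N.2), ?_⟩
  convert DirectSum.isInternal_submodule_of_iSupIndep_of_iSup_eq_top hind' htop'

theorem isCompletelyReducible_of_forall_eq_top
    (hle : ∀ K, W.IsSubmodule K → (∀ S, W.IsSimpleSubmodule S → S ≤ K) → K = ⊤) :
    W.IsCompletelyReducible := by
  refine isCompletelyReducible_of_isSemisimpleModule (.of_sSup_simples_eq_top ?_)
  refine Submodule.restrictScalars_injective ℂ _ _
    (hle _ (isSubmodule_restrictScalars _) fun S hS => ?_)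
  have : IsSimpleModule W.modeAlgebra hS.1.toModeAlgebra :=
    isSimpleSubmodule_restrictScalars_iff.1 hS
  exact le_sSup (show hS.1.toModeAlgebra ∈ {m : Submodule _ _ | IsSimpleModule W.modeAlgebra m} from this)

end Semisimple

end WeakModule

end VertexOperatorAlgebra

/-! ### The theorem -/

theorem proposition9 {V : Type u} [AddCommGroup V] [Module ℂ V]
    (A : VertexOperatorAlgebra V)
    (hol : VertexOperatorAlgebra.IsHolomorphic.{u, v} A)
    (hV1 : A.weightSpace 1 = ⊥)
    {M : Type v} [AddCommGroup M] [Module ℂ M]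
    (W : A.WeakModule M) (hW : W.IsOrdinary) :
    W.IsCompletelyReducible := by
  have h1 : W.weightSpace 1 = ⊥ := by
    by_contra h
    refine VertexOperatorAlgebra.WeakModule.weightSpace_adjoint_ne_bot hol hW h ?_
    rw [← hV1, VertexOperatorAlgebra.weightSpace, Int.cast_one]
    rfl
  refine VertexOperatorAlgebra.WeakModule.isCompletelyReducible_of_forall_eq_top
    fun K hK hsimple => ?_
  by_contra hne
  have : Nontrivial (M ⧸ K) := Submodule.Quotient.nontrivial_iff.2 hne
  refine VertexOperatorAlgebra.WeakModule.weightSpace_zero_ne_bot hol (hW.quotient hK) ?_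
  -- The weight-0 space of `M ⧸ K` is the image of `M_0`, so it remains to place `M_0` inside `K`.
  rw [hW.quotient_weightSpace, ← LinearMap.le_ker_iff_map, Submodule.ker_mkQ]
  intro w hw
  rcases eq_or_ne w 0 with rfl | hw0
  · exact K.zero_mem
  have hL : W.mode A.ω 0 w = 0 := by
    have := VertexOperatorAlgebra.WeakModule.mode_omega_zero_mem_weightSpace hw
    rwa [zero_add, h1, Submodule.mem_bot] at this
  have hs := VertexOperatorAlgebra.WeakModule.isSimpleSubmodule_range_creationMap hol.1 hL hw0
  exact hsimple _ hs.1 hs.2
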